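/- Let $r$ be a prime power, let $X=\mathbf V(x_0^{r+1}+x_1^{r+1}+x_2^{r+1}+x_3^{r+1})\subset\mathbb P^3$ be the Hermitian surface over $\mathbb F_{r^2}$, and let $\mathcal S=X(\mathbb F_{r^2})=\{P_1,\dots,P_n\}$ be its set of $\mathbb F_{r^2}$-rational points. For each $i$ choose any homogeneous coordinate vector $v_i\in\mathbb F_{r^2}^4\setminus\{0\}$ of $P_i$. For an integer $h\ge 0$ let $C_h(X)\subseteq\mathbb F_{r^2}^n$ be the code consisting of all vectors $(f(v_1),\dots,f(v_n))$, where $f$ runs over the homogeneous polynomials of degree $h$ in $\mathbb F_{r^2}[x_0,x_1,x_2,x_3]$ (together with $0$). If $h<r+1$, then $C_h(X)$ has block length \[ n=(r^2+1)(r^3+1), \] dimension \[ k=\dim_{\mathbb F_{r^2}} C_h(X)=\binom{3+h}{h}, \] and its minimum distance $d$ (the least Hamming distance between two distinct codewords) satisfies \[ d\ \ge\ n-h(r+1)(r^2+1). \] -/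

import Mathlib

open scoped LinearAlgebra.Projectivization

namespace HermitianSurfaceCode

/-- The Fermat-type form `x₀^(r+1) + x₁^(r+1) + x₂^(r+1) + x₃^(r+1)`. -/
noncomputable def hermitianForm (F : Type*) [Field F] (r : ℕ) : MvPolynomial (Fin 4) F :=
  ∑ i, MvPolynomial.X i ^ (r + 1)

/-- The `F`-rational points of the Hermitian surface in projective 3-space: the points of
`ℙ³(F)` all of whose homogeneous coordinate vectors are zeros of the Hermitian form. -/
def rationalPoints (F : Type*) [Field F] (r : ℕ) : Set (ℙ F (Fin 4 → F)) :=
  {P | ∀ (v : Fin 4 → F) (hv : v ≠ 0), Projectivization.mk F v hv = P →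
    MvPolynomial.eval v (hermitianForm F r) = 0}

/-- `IsCoordinateChoice S v`: for every point of `S`, `v` selects one homogeneous
coordinate vector of that point. -/
def IsCoordinateChoice {F σ : Type*} [Field F] (S : Set (ℙ F (σ → F)))
    (v : S → σ → F) : Prop :=
  ∀ P : S, ∃ hv : v P ≠ 0, Projectivization.mk F (v P) hv = P

/-- The evaluation map `f ↦ (f(v_P))_{P ∈ ι}` on polynomials. -/
noncomputable def evalMap {F σ ι : Type*} [Field F] (v : ι → σ → F) :
    MvPolynomial σ F →ₗ[F] (ι → F) :=
  LinearMap.pi fun P => (MvPolynomial.aeval (v P)).toLinearMap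

/-- The evaluation code of the forms of degree `h`: the image under the evaluation map of the
space of homogeneous polynomials of degree `h` (including `0`). -/
noncomputable def evalCode {F σ ι : Type*} [Field F] (h : ℕ) (v : ι → σ → F) :
    Submodule F (ι → F) :=
  (MvPolynomial.homogeneousSubmodule σ F h).map (evalMap v)

open Classical in
/-- The minimum distance of a code: the least Hamming distance between two distinct
codewords. -/
noncomputable def minDist {F ι : Type*} [Field F] [Finite ι] (C : Submodule F (ι → F)) : ℕ :=
  letI := Fintype.ofFinite ι
  sInf {d | ∃ x ∈ C, ∃ y ∈ C, x ≠ y ∧ hammingDist x y = d}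

end HermitianSurfaceCode

namespace HermitianSurfaceCode

/-! Put q = r². Each nonzero norm value has r + 1 preimages under x ↦ x ^ (r + 1) and zero has one.
Adding one coordinate at a time thus gives a recurrence for the number of isotropic vectors;
removing 0 and dividing by q - 1 counts the points.

A nonzero form f of degree h ≤ r is nonzero at some point B of the surface: on the subset x₀ ^ (r +
1) + x₁ ^ (r + 1) = 0 = x₂ ^ (r + 1) + x₃ ^ (r + 1) the coordinates can be chosen successively, each
with more than h possible values (`exists_eval_ne_zero`). Hence evaluation is injective on forms,
which gives the dimension.

For the distance, take a line ℓ of the surface through B. The q + 1 planes through ℓ are the tangent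
planes at the points of ℓ, and each meets the surface in ℓ and at most r further lines through its
point of tangency (`exists_finset_of_isotropic`). So these lines cover the surface. A line on which
f is not identically zero carries at most h zeros. If f vanishes on k of the further lines through a
point of ℓ, then f restricted to ℓ has a zero of order at least k there (`pow_dvd_linePoly`); so f
vanishes on at most h further lines in all, each adding at most q zeros off ℓ. The total is at most
h + (q + 1)rh + qh = h(r + 1)(q + 1). -/

/-! ### Norms and the number of points -/

open Polynomial in
/-- In a field with `r ^ 2` elements, every nonzero `c` of the subfield with `r` elements is
a norm in exactly `r + 1` ways. -/
theorem card_norm_fiber {F : Type*} [Field F] [Fintype F] [DecidableEq F] {r : ℕ}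
    (hF : Fintype.card F = r ^ 2) {c : F} (hc : c ≠ 0) (hcr : c ^ r = c) :
    (Finset.univ.filter fun x : F => x ^ (r + 1) = c).card = r + 1 := by
  have hr : r ≠ 0 := by
    rintro rfl
    simp at hF
  obtain ⟨k, rfl⟩ := Nat.exists_eq_succ_of_ne_zero hr
  have hck : c ^ k = 1 := by
    have : c ^ k * c = 1 * c := by rw [← pow_succ, one_mul]; exact hcr
    exact mul_right_cancel₀ hc this
  -- Here k = r - 1 and (r + 1)(r - 1) = q - 1, so X ^ (r + 1) - c divides X ^ (q - 1) - 1. It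
  -- inherits distinct roots in F.
  have hdvd : (X ^ (k + 1 + 1) - C c : F[X]) ∣ X ^ Fintype.card F - X := by
    have h1 : (X ^ (k + 1 + 1) - C c : F[X]) ∣ (X ^ (k + 1 + 1)) ^ k - (C c) ^ k :=
      sub_dvd_pow_sub_pow _ _ _
    rw [← C_pow, hck, C_1] at h1
    refine h1.trans ⟨X, ?_⟩
    rw [hF, sub_mul, one_mul, ← pow_mul, ← pow_succ]
    congr 2
    simp only [Nat.succ_eq_add_one]
    ring
  have hq : (X ^ Fintype.card F - X : F[X]) ≠ 0 :=
    FiniteField.X_pow_card_sub_X_ne_zero F Fintype.one_lt_card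
  have hs : (X ^ (k + 1 + 1) - C c : F[X]).Splits :=
    Splits.of_dvd (splits_iff_card_roots.2 (by
      rw [FiniteField.roots_X_pow_card_sub_X,
        FiniteField.X_pow_card_sub_X_natDegree_eq F Fintype.one_lt_card]
      rfl)) hq hdvd
  have hle := roots.le_of_dvd hq hdvd
  rw [FiniteField.roots_X_pow_card_sub_X] at hle
  have hnd : (X ^ (k + 1 + 1) - C c : F[X]).roots.Nodup :=
    Multiset.nodup_of_le hle Finset.univ.nodup
  have hcard := hs.natDegree_eq_card_roots
  rw [natDegree_X_pow_sub_C, ← Multiset.toFinset_card_of_nodup hnd] at hcard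
  refine Eq.trans ?_ hcard.symm
  congr 1
  ext x
  simp [mem_roots (X_pow_sub_C_ne_zero (Nat.succ_pos (k + 1)) c), sub_eq_zero]

/-- In a field with `r ^ 2` elements, `x ↦ x ^ r` is additive. -/
theorem add_pow_of_card_eq_sq {F : Type*} [Field F] [Fintype F] {r : ℕ}
    (hF : Fintype.card F = r ^ 2) (x y : F) : (x + y) ^ r = x ^ r + y ^ r := by
  obtain ⟨p, hp⟩ := CharP.exists F
  obtain ⟨n, hprime, hn⟩ := FiniteField.card F p
  have : Fact p.Prime := ⟨hprime⟩
  -- This makes r a power of the characteristic, so x ↦ x ^ r is an iterate of Frobenius.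
  have hdvd : r ∣ p ^ (n : ℕ) := by
    rw [← hn, hF]
    exact dvd_pow_self r two_ne_zero
  obtain ⟨m, -, rfl⟩ := (Nat.dvd_prime_pow hprime).1 hdvd
  exact add_pow_char_pow x y p m

theorem two_le_of_card_eq_sq {F : Type*} [Field F] [Fintype F] {r : ℕ}
    (hF : Fintype.card F = r ^ 2) : 2 ≤ r := by
  have h := Fintype.one_lt_card (α := F)
  rw [hF] at h
  by_contra hr
  have : r = 0 ∨ r = 1 := by omega
  rcases this with rfl | rfl <;> simp at h

theorem pow_pow_of_card_eq_sq {F : Type*} [Field F] [Fintype F] {r : ℕ}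
    (hF : Fintype.card F = r ^ 2) (x : F) : (x ^ r) ^ r = x := by
  rw [← pow_mul, ← sq, ← hF, FiniteField.pow_card]

theorem neg_pow_of_card_eq_sq {F : Type*} [Field F] [Fintype F] {r : ℕ}
    (hF : Fintype.card F = r ^ 2) (x : F) : (-x) ^ r = -x ^ r := by
  have h := add_pow_of_card_eq_sq hF x (-x)
  have hr := two_le_of_card_eq_sq hF
  rw [add_neg_cancel, zero_pow (by omega)] at h
  exact eq_neg_of_add_eq_zero_right h.symm

theorem norm_pow_of_card_eq_sq {F : Type*} [Field F] [Fintype F] {r : ℕ}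
    (hF : Fintype.card F = r ^ 2) (x : F) : (x ^ (r + 1)) ^ r = x ^ (r + 1) := by
  rw [← pow_mul, mul_comm, pow_mul, pow_succ, pow_pow_of_card_eq_sq hF, pow_succ, mul_comm]

theorem sum_norm_pow_of_card_eq_sq {F ι : Type*} [Field F] [Fintype F] {r : ℕ}
    (hF : Fintype.card F = r ^ 2) (s : Finset ι) (x : ι → F) :
    (∑ i ∈ s, x i ^ (r + 1)) ^ r = ∑ i ∈ s, x i ^ (r + 1) := by
  classical
  have hr := two_le_of_card_eq_sq hF
  induction s using Finset.induction_on with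
  | empty => simp; omega
  | insert a s ha ih =>
    rw [Finset.sum_insert ha, add_pow_of_card_eq_sq hF, ih, norm_pow_of_card_eq_sq hF]

/-- The number of vectors of length `k + 1` whose norms sum to zero, in terms of the same number
for length `k`. -/
theorem card_isotropic_succ {F : Type*} [Field F] [Fintype F] [DecidableEq F] {r : ℕ}
    (hF : Fintype.card F = r ^ 2) (k : ℕ) :
    (((Finset.univ.filter fun x : Fin (k + 1) → F => ∑ i, x i ^ (r + 1) = 0).card : ℕ) : ℤ) =
      (r + 1) * (r ^ 2) ^ k -
        r * (Finset.univ.filter fun x : Fin k → F => ∑ i, x i ^ (r + 1) = 0).card := by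
  have hsplit : (Finset.univ.filter fun x : Fin (k + 1) → F => ∑ i, x i ^ (r + 1) = 0).card =
      ∑ y : Fin k → F,
        (Finset.univ.filter fun a : F => a ^ (r + 1) + ∑ i, y i ^ (r + 1) = 0).card := by
    simp only [Finset.card_filter]
    rw [← (Fin.consEquiv fun _ : Fin (k + 1) => F).sum_comp, Fintype.sum_prod_type_right]
    simp [Fin.consEquiv, Fin.sum_univ_succ]
  -- One extension if the remaining norms already sum to zero, r + 1 otherwise.
  have hfib (y : Fin k → F) :
      (((Finset.univ.filter fun a : F => a ^ (r + 1) + ∑ i, y i ^ (r + 1) = 0).card : ℕ) : ℤ) =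
        (r + 1) - r * (if ∑ i, y i ^ (r + 1) = 0 then 1 else 0) := by
    split_ifs with hy
    · have : (Finset.univ.filter fun a : F => a ^ (r + 1) + ∑ i, y i ^ (r + 1) = 0) = {0} := by
        ext a
        simp [hy]
      simp [this]
    · have := card_norm_fiber hF (c := -∑ i, y i ^ (r + 1)) (neg_ne_zero.2 hy)
        (by rw [neg_pow_of_card_eq_sq hF, sum_norm_pow_of_card_eq_sq hF])
      simp only [eq_neg_iff_add_eq_zero] at this
      rw [this]
      simp
  rw [hsplit]
  push_cast
  rw [Finset.sum_congr rfl fun y _ => hfib y, Finset.sum_sub_distrib, ← Finset.mul_sum]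
  simp [hF]
  ring

theorem card_isotropic_four {F : Type*} [Field F] [Fintype F] [DecidableEq F] {r : ℕ}
    (hF : Fintype.card F = r ^ 2) :
    (((Finset.univ.filter fun x : Fin 4 → F => ∑ i, x i ^ (r + 1) = 0).card : ℕ) : ℤ) =
      1 + (r ^ 2 - 1) * ((r ^ 2 + 1) * (r ^ 3 + 1)) := by
  rw [card_isotropic_succ hF 3, card_isotropic_succ hF 2, card_isotropic_succ hF 1,
    card_isotropic_succ hF 0]
  simp
  ring

theorem eval_hermitianForm {F : Type*} [Field F] (r : ℕ) (x : Fin 4 → F) :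
    MvPolynomial.eval x (hermitianForm F r) = ∑ i, x i ^ (r + 1) := by
  simp [hermitianForm]

theorem mk_mem_rationalPoints {F : Type*} [Field F] {r : ℕ} {x : Fin 4 → F} (hx : x ≠ 0) :
    Projectivization.mk F x hx ∈ rationalPoints F r ↔ ∑ i, x i ^ (r + 1) = 0 := by
  constructor
  · intro h
    rw [← eval_hermitianForm]
    exact h x hx rfl
  · intro h w hw hwx
    obtain ⟨a, rfl⟩ := (Projectivization.mk_eq_mk_iff' F w x hw hx).1 hwx
    rw [eval_hermitianForm]
    simp [mul_pow, ← Finset.mul_sum, h]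

theorem IsCoordinateChoice.sum_pow_eq_zero {F : Type*} [Field F] {r : ℕ}
    {v : rationalPoints F r → Fin 4 → F} (hv : IsCoordinateChoice (rationalPoints F r) v)
    (P : rationalPoints F r) : ∑ i, v P i ^ (r + 1) = 0 := by
  obtain ⟨h0, h⟩ := hv P
  rw [← mk_mem_rationalPoints h0, h]
  exact P.2

/-- Every nonzero isotropic vector is a unit multiple of exactly one chosen coordinate vector. -/
theorem IsCoordinateChoice.bijective_smul {F : Type*} [Field F] {r : ℕ}
    {v : rationalPoints F r → Fin 4 → F} (hv : IsCoordinateChoice (rationalPoints F r) v) :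
    Function.Bijective (fun p : rationalPoints F r × Fˣ =>
      (⟨p.2 • v p.1, by
        obtain ⟨h0, -⟩ := hv p.1
        refine ⟨(smul_ne_zero_iff_ne p.2).2 h0, ?_⟩
        simp [Units.smul_def, mul_pow, ← Finset.mul_sum, hv.sum_pow_eq_zero]⟩ :
        {x : Fin 4 → F // x ≠ 0 ∧ ∑ i, x i ^ (r + 1) = 0})) := by
  constructor
  · rintro ⟨P, a⟩ ⟨Q, b⟩ h
    have h' : a • v P = b • v Q := congrArg Subtype.val h
    obtain ⟨hP0, hP⟩ := hv P
    obtain ⟨hQ0, hQ⟩ := hv Q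
    have hPQ : P = Q := by
      apply Subtype.ext
      rw [← hP, ← hQ, Projectivization.mk_eq_mk_iff]
      exact ⟨a⁻¹ * b, by rw [mul_smul, ← h', inv_smul_smul]⟩
    subst hPQ
    have : (a : F) • v P = (b : F) • v P := h'
    rw [Prod.mk.injEq]
    exact ⟨rfl, Units.ext (smul_left_injective F hP0 this)⟩
  · rintro ⟨x, hx0, hx⟩
    let P : rationalPoints F r := ⟨Projectivization.mk F x hx0, (mk_mem_rationalPoints hx0).2 hx⟩
    obtain ⟨hP0, hP⟩ := hv P
    obtain ⟨a, ha⟩ := (Projectivization.mk_eq_mk_iff F x (v P) hx0 hP0).1 hP.symm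
    exact ⟨⟨P, a⟩, Subtype.ext ha⟩

theorem card_rationalPoints {F : Type*} [Field F] [Fintype F] {r : ℕ}
    (hF : Fintype.card F = r ^ 2) {v : rationalPoints F r → Fin 4 → F}
    (hv : IsCoordinateChoice (rationalPoints F r) v) :
    Nat.card (rationalPoints F r) = (r ^ 2 + 1) * (r ^ 3 + 1) := by
  classical
  have h1 := Nat.card_congr (Equiv.ofBijective _ hv.bijective_smul)
  rw [Nat.card_prod, Nat.card_eq_fintype_card (α := Fˣ), Fintype.card_units, hF,
    Nat.card_eq_fintype_card (α := {x : Fin 4 → F // _}), Fintype.card_subtype] at h1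
  have h2 : (Finset.univ.filter fun x : Fin 4 → F => ∑ i, x i ^ (r + 1) = 0) =
      insert 0 (Finset.univ.filter fun x : Fin 4 → F => x ≠ 0 ∧ ∑ i, x i ^ (r + 1) = 0) := by
    ext x
    by_cases hx : x = 0 <;> simp [hx]
  have h3 := card_isotropic_four hF
  have hr := two_le_of_card_eq_sq hF
  have hr2 : 1 < r ^ 2 := by nlinarith
  rw [h2, Finset.card_insert_of_notMem (by simp), ← h1] at h3
  push_cast [Nat.cast_sub hr2.le] at h3
  have h4 : ((r : ℤ) ^ 2 - 1) ≠ 0 := by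
    have : (1 : ℤ) < (r : ℤ) ^ 2 := by exact_mod_cast hr2
    omega
  have h5 : (Nat.card (rationalPoints F r) : ℤ) = (r ^ 2 + 1) * (r ^ 3 + 1) := by
    apply mul_left_cancel₀ h4
    linarith
  exact_mod_cast h5

/-! ### Forms are determined by their values on the surface -/

/-- The forms of degree `h` in `n` variables form a space of dimension `(n + h - 1).choose h`. -/
theorem finrank_homogeneousSubmodule (F : Type*) [Field F] (n h : ℕ) :
    Module.finrank F (MvPolynomial.homogeneousSubmodule (Fin n) F h) = (n + h - 1).choose h := by
  classical
  rw [MvPolynomial.homogeneousSubmodule_eq_finsupp_supported]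
  have hset : {d : Fin n →₀ ℕ | d.degree = h} =
      ↑((Finset.univ : Finset (Fin n)).finsuppAntidiag h) := by
    ext d
    simp [Finsupp.degree_eq_sum]
  have e := AddMonoidAlgebra.supportedEquivFinsupp (R := F) (S := F) {d : Fin n →₀ ℕ | d.degree = h}
  refine (LinearEquiv.finrank_eq e).trans ?_
  rw [hset, Module.finrank_finsupp_self]
  simp [Finset.card_finsuppAntidiag_nat_eq_choose]

/-- If polynomials of degree at most `h` in `n` variables are determined by their values on `S`, and
over each point of `S` there are more than `h` points of `T`, then polynomials of degree at most `h`
in `n + 1` variables are determined by their values on `T`. -/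
theorem eq_zero_of_forall_fiber {F : Type*} [Field F] {n h : ℕ} {S : Set (Fin n → F)}
    {T : Set (Fin (n + 1) → F)}
    (hS : ∀ g : MvPolynomial (Fin n) F, g.totalDegree ≤ h →
      (∀ y ∈ S, MvPolynomial.eval y g = 0) → g = 0)
    (hT : ∀ y ∈ S, ∃ s : Finset F, h < s.card ∧ ∀ a ∈ s, (Fin.cons a y : Fin (n + 1) → F) ∈ T)
    (f : MvPolynomial (Fin (n + 1)) F) (hf : f.totalDegree ≤ h)
    (hfT : ∀ x ∈ T, MvPolynomial.eval x f = 0) : f = 0 := by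
  apply (MvPolynomial.finSuccEquiv F n).injective
  rw [map_zero]
  ext1 i
  rw [Polynomial.coeff_zero]
  by_contra hi
  have hdeg := MvPolynomial.totalDegree_coeff_finSuccEquiv_add_le f i hi
  refine hi (hS _ (by omega) fun y hy => ?_)
  obtain ⟨s, hs, hsT⟩ := hT y hy
  have hp : Polynomial.map (MvPolynomial.eval y) (MvPolynomial.finSuccEquiv F n f) = 0 := by
    refine Polynomial.eq_zero_of_natDegree_lt_card_of_eval_eq_zero' _ s (fun a ha => ?_) ?_
    · rw [← MvPolynomial.eval_eq_eval_mv_eval']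
      exact hfT _ (hsT a ha)
    · refine lt_of_le_of_lt ?_ hs
      refine Polynomial.natDegree_map_le.trans ?_
      rw [MvPolynomial.natDegree_finSuccEquiv]
      exact (MvPolynomial.degreeOf_le_totalDegree f 0).trans hf
  rw [← Polynomial.coeff_map, hp, Polynomial.coeff_zero]

/-- A nonzero polynomial of degree at most `r` is nonzero at some point of the surface that lies
on the intersection of `x₀ ^ (r + 1) + x₁ ^ (r + 1) = 0` and `x₂ ^ (r + 1) + x₃ ^ (r + 1) = 0`. -/
theorem exists_eval_ne_zero {F : Type*} [Field F] [Fintype F] {r h : ℕ}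
    (hF : Fintype.card F = r ^ 2) (hh : h < r + 1) {f : MvPolynomial (Fin 4) F}
    (hf : f.totalDegree ≤ h) (hf0 : f ≠ 0) :
    ∃ b : Fin 4 → F, b 1 ≠ 0 ∧ b 3 ≠ 0 ∧ b 0 ^ (r + 1) + b 1 ^ (r + 1) = 0 ∧
      b 2 ^ (r + 1) + b 3 ^ (r + 1) = 0 ∧ MvPolynomial.eval b f ≠ 0 := by
  classical
  have hr := two_le_of_card_eq_sq hF
  have hunits : h < (Finset.univ.erase (0 : F)).card := by
    rw [Finset.card_erase_of_mem (Finset.mem_univ _), Finset.card_univ, hF]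
    have : r + 2 ≤ r ^ 2 := by nlinarith
    omega
  have hnorm (c : F) (hc : c ≠ 0) : ∃ s : Finset F, h < s.card ∧
      ∀ a ∈ s, a ^ (r + 1) + c ^ (r + 1) = 0 := by
    refine ⟨Finset.univ.filter fun x : F => x ^ (r + 1) = -c ^ (r + 1), ?_, ?_⟩
    · rw [card_norm_fiber hF (neg_ne_zero.2 (pow_ne_zero _ hc))]
      · exact hh
      · rw [neg_pow_of_card_eq_sq hF, norm_pow_of_card_eq_sq hF]
    · intro a ha
      rw [← eq_neg_iff_add_eq_zero]
      simpa using ha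
  by_contra! hcon
  -- Coordinates are peeled off from x₀ to x₃: x₃ and x₁ range over the q - 1 units, x₂ and x₀ over
  -- norm fibres of size r + 1.
  refine hf0 (eq_zero_of_forall_fiber (S := {y : Fin 3 → F | y 0 ≠ 0 ∧ y 2 ≠ 0 ∧
      y 1 ^ (r + 1) + y 2 ^ (r + 1) = 0})
    (T := {x | x 1 ≠ 0 ∧ x 3 ≠ 0 ∧ x 0 ^ (r + 1) + x 1 ^ (r + 1) = 0 ∧
      x 2 ^ (r + 1) + x 3 ^ (r + 1) = 0}) ?_ ?_ f hf
    fun x hx => hcon x hx.1 hx.2.1 hx.2.2.1 hx.2.2.2)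
  · refine eq_zero_of_forall_fiber (S := {y : Fin 2 → F | y 1 ≠ 0 ∧
      y 0 ^ (r + 1) + y 1 ^ (r + 1) = 0}) ?_ ?_
    · refine eq_zero_of_forall_fiber (S := {y : Fin 1 → F | y 0 ≠ 0}) ?_ ?_
      · refine eq_zero_of_forall_fiber (S := Set.univ) ?_ ?_
        · intro g _ hg
          rw [MvPolynomial.eq_C_of_isEmpty g] at hg ⊢
          have := hg 0 trivial
          rw [MvPolynomial.eval_C] at this
          rw [this, map_zero]
        · exact fun y _ => ⟨_, hunits, fun a ha => Finset.ne_of_mem_erase ha⟩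
      · intro y hy
        obtain ⟨s, hs, hs'⟩ := hnorm (y 0) hy
        exact ⟨s, hs, fun a ha => ⟨hy, hs' a ha⟩⟩
    · exact fun y hy => ⟨_, hunits, fun a ha => ⟨Finset.ne_of_mem_erase ha, hy⟩⟩
  · intro y hy
    obtain ⟨s, hs, hs'⟩ := hnorm (y 0) hy.1
    exact ⟨s, hs, fun a ha => ⟨hy.1, hy.2.1, hs' a ha, hy.2.2⟩⟩

/-! ### Restriction to lines and planes -/

theorem eval_smul_of_isHomogeneous {F σ : Type*} [Field F] {f : MvPolynomial σ F} {h : ℕ}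
    (hf : f.IsHomogeneous h) (a : F) (x : σ → F) :
    MvPolynomial.eval (a • x) f = a ^ h * MvPolynomial.eval x f := by
  rw [MvPolynomial.eval_eq, MvPolynomial.eval_eq, Finset.mul_sum]
  refine Finset.sum_congr rfl fun d hd => ?_
  have hdeg : ∑ i ∈ d.support, d i = h := by
    rw [hf.degree_eq_sum_deg_support hd]
  simp only [Pi.smul_apply, smul_eq_mul, mul_pow, Finset.prod_mul_distrib,
    Finset.prod_pow_eq_pow_sum, hdeg]
  ring

/-- The restriction `u ↦ f (x + u y)` of `f` to a line, as a polynomial in `u`. -/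
noncomputable def linePoly {F σ : Type*} [Field F] (f : MvPolynomial σ F) (x y : σ → F) :
    Polynomial F :=
  MvPolynomial.aeval (fun i => Polynomial.C (x i) + Polynomial.X * Polynomial.C (y i)) f

theorem eval_linePoly {F σ : Type*} [Field F] (f : MvPolynomial σ F) (x y : σ → F) (u : F) :
    (linePoly f x y).eval u = MvPolynomial.eval (x + u • y) f := by
  rw [linePoly, ← Polynomial.coe_aeval_eq_eval, MvPolynomial.comp_aeval_apply,
    ← MvPolynomial.coe_aeval_eq_eval, RingHom.coe_coe]
  congr 2
  ext i
  simp
  ring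

theorem natDegree_linePoly_le {F σ : Type*} [Field F] {f : MvPolynomial σ F} {h : ℕ}
    (hf : f.totalDegree ≤ h) (x y : σ → F) : (linePoly f x y).natDegree ≤ h := by
  rw [← mul_one h]
  exact MvPolynomial.aeval_natDegree_le f hf _ fun i => by compute_degree

/-- Whether a form vanishes on the line through `x` and `y` does not depend on which of the two
points is taken as origin. -/
theorem linePoly_swap_eq_zero {F σ : Type*} [Field F] [Fintype F] {f : MvPolynomial σ F} {h : ℕ}
    (hf : f.IsHomogeneous h) (hh : h + 1 < Fintype.card F) {x y : σ → F}
    (hxy : linePoly f x y = 0) : linePoly f y x = 0 := by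
  classical
  refine Polynomial.eq_zero_of_natDegree_lt_card_of_eval_eq_zero' _
    (Finset.univ.erase (0 : F)) (fun u hu => ?_) ?_
  · have hu0 : u ≠ 0 := Finset.ne_of_mem_erase hu
    have hsmul : y + u • x = u • (x + u⁻¹ • y) := by
      rw [smul_add, smul_smul, mul_inv_cancel₀ hu0, one_smul, add_comm]
    rw [eval_linePoly, hsmul, eval_smul_of_isHomogeneous hf, ← eval_linePoly, hxy]
    simp
  · rw [Finset.card_erase_of_mem (Finset.mem_univ _), Finset.card_univ]
    have := natDegree_linePoly_le hf.totalDegree_le y x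
    omega

/-- The direction y is the point at infinity of the parametrized line, so it becomes the parameter 0
after the swap. -/
theorem linePoly_ne_zero {F σ : Type*} [Field F] [Fintype F] {f : MvPolynomial σ F} {h : ℕ}
    (hf : f.IsHomogeneous h) (hh : h + 1 < Fintype.card F) {y : σ → F}
    (hy : MvPolynomial.eval y f ≠ 0) (x : σ → F) : linePoly f x y ≠ 0 := by
  intro h0
  apply hy
  have := eval_linePoly f y x 0
  rw [linePoly_swap_eq_zero hf hh h0] at this
  simpa using this.symm

/-- The restriction `(u, s) ↦ f (x + u z + s y)` of `f` to a plane, as a polynomial in `s` over the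
polynomials in `u`. -/
noncomputable def planePoly {F σ : Type*} [Field F] (f : MvPolynomial σ F) (x y z : σ → F) :
    Polynomial (Polynomial F) :=
  MvPolynomial.aeval (fun i =>
    Polynomial.C (Polynomial.C (x i) + Polynomial.X * Polynomial.C (z i)) +
      Polynomial.X * Polynomial.C (Polynomial.C (y i))) f

/-- In the plane coordinates (u, s), the line through x + t y with direction c y + z is s = t + c u.
-/
theorem eval_planePoly {F σ : Type*} [Field F] (f : MvPolynomial σ F) (x y z : σ → F) (t c : F) :
    (planePoly f x y z).eval (Polynomial.C t + Polynomial.X * Polynomial.C c) =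
      linePoly f (x + t • y) (c • y + z) := by
  have := MvPolynomial.comp_aeval_apply (R := F)
    (fun i => Polynomial.C (Polynomial.C (x i) + Polynomial.X * Polynomial.C (z i)) +
      Polynomial.X * Polynomial.C (Polynomial.C (y i)))
    ((Polynomial.aeval (R := Polynomial F)
      (Polynomial.C t + Polynomial.X * Polynomial.C c)).restrictScalars F) f
  simp only [AlgHom.restrictScalars_apply, Polynomial.coe_aeval_eq_eval] at this
  rw [planePoly, this, linePoly]
  congr 2
  ext1 i
  simp
  ring

theorem map_planePoly {F σ : Type*} [Field F] (f : MvPolynomial σ F) (x y z : σ → F) :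
    (planePoly f x y z).map (Polynomial.evalRingHom 0) = linePoly f x y := by
  have := MvPolynomial.comp_aeval_apply (R := F)
    (fun i => Polynomial.C (Polynomial.C (x i) + Polynomial.X * Polynomial.C (z i)) +
      Polynomial.X * Polynomial.C (Polynomial.C (y i)))
    (Polynomial.mapAlgHom (Polynomial.aeval (R := F) (0 : F))) f
  rw [linePoly]
  refine Eq.trans this ?_
  congr 2
  ext1 i
  simp [Polynomial.mapAlgHom]

/-- If `f` vanishes on `k` lines through `x + t y` of a plane containing the line through `x` and
`y`, then it vanishes to order at least `k` at `x + t y` along this line. -/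
theorem pow_dvd_linePoly {F σ : Type*} [Field F] {f : MvPolynomial σ F} {x y z : σ → F} {t : F}
    (h0 : linePoly f x y ≠ 0) (s : Finset F)
    (hs : ∀ c ∈ s, linePoly f (x + t • y) (c • y + z) = 0) :
    (Polynomial.X - Polynomial.C t) ^ s.card ∣ linePoly f x y := by
  have hne : planePoly f x y z ≠ 0 := by
    intro h
    apply h0
    rw [← map_planePoly f x y z, h, Polynomial.map_zero]
  have hinj : Function.Injective fun c : F => Polynomial.C t + Polynomial.X * Polynomial.C c := by
    intro c d hcd
    have := congrArg (fun p : Polynomial F => p.coeff 1) hcd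
    simpa [Polynomial.coeff_C] using this
  have hle : (s.map ⟨_, hinj⟩).val ≤ (planePoly f x y z).roots := by
    rw [Finset.val_le_iff_val_subset]
    intro p hp
    obtain ⟨c, hc, rfl⟩ := Finset.mem_map.1 hp
    rw [Polynomial.mem_roots hne]
    exact (eval_planePoly f x y z t c).trans (hs c hc)
  -- The factors s - (t + c u) all become s - t on setting u = 0.
  have hdvd := (Multiset.prod_X_sub_C_dvd_iff_le_roots hne _).2 hle
  have := Polynomial.map_dvd (Polynomial.evalRingHom 0) hdvd
  rw [map_planePoly] at this
  refine dvd_trans (dvd_of_eq ?_) this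
  rw [← Finset.prod_eq_multiset_prod, Finset.prod_map, Polynomial.map_prod]
  simp

/-! ### The Hermitian form and tangent planes -/

/-- The sesquilinear form `∑ xᵢ yᵢ ^ r`. -/
def herm {F : Type*} [Field F] (r : ℕ) (x y : Fin 4 → F) : F := ∑ i, x i * y i ^ r

theorem herm_add_left {F : Type*} [Field F] (r : ℕ) (x y z : Fin 4 → F) :
    herm r (x + y) z = herm r x z + herm r y z := by
  simp [herm, add_mul, Finset.sum_add_distrib]

theorem herm_smul_left {F : Type*} [Field F] (r : ℕ) (a : F) (x y : Fin 4 → F) :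
    herm r (a • x) y = a * herm r x y := by
  simp [herm, mul_assoc, Finset.mul_sum]

theorem herm_smul_right {F : Type*} [Field F] (r : ℕ) (a : F) (x y : Fin 4 → F) :
    herm r x (a • y) = a ^ r * herm r x y := by
  simp [herm, mul_pow, mul_left_comm, Finset.mul_sum]

theorem herm_add_right {F : Type*} [Field F] [Fintype F] {r : ℕ} (hF : Fintype.card F = r ^ 2)
    (x y z : Fin 4 → F) : herm r x (y + z) = herm r x y + herm r x z := by
  simp [herm, add_pow_of_card_eq_sq hF, mul_add, Finset.sum_add_distrib]

theorem herm_symm {F : Type*} [Field F] [Fintype F] {r : ℕ} (hF : Fintype.card F = r ^ 2)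
    (x y : Fin 4 → F) : herm r y x = herm r x y ^ r := by
  simp [herm, Fin.sum_univ_four, add_pow_of_card_eq_sq hF, mul_pow, pow_pow_of_card_eq_sq hF,
    mul_comm]

theorem herm_eq_zero_symm {F : Type*} [Field F] [Fintype F] {r : ℕ}
    (hF : Fintype.card F = r ^ 2) {x y : Fin 4 → F} (h : herm r x y = 0) : herm r y x = 0 := by
  have := two_le_of_card_eq_sq hF
  rw [herm_symm hF, h, zero_pow (by omega)]

theorem herm_self {F : Type*} [Field F] (r : ℕ) (x : Fin 4 → F) :
    herm r x x = ∑ i, x i ^ (r + 1) := by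
  simp [herm, pow_succ']

/-- Besides the line through the orthogonal isotropic vectors `p` and `c`, the tangent plane at `p`
contains at most `r` lines of the surface through `p`. -/
theorem exists_finset_of_isotropic {F : Type*} [Field F] [Fintype F] {r : ℕ}
    (hF : Fintype.card F = r ^ 2) {p c z : Fin 4 → F} (hpp : herm r p p = 0)
    (hcc : herm r c c = 0) (hcp : herm r c p = 0) (hzp : herm r z p = 0) (hzc : herm r z c ≠ 0) :
    ∃ Γ : Finset F, Γ.card ≤ r ∧ ∀ a b d : F, d ≠ 0 →
      herm r (a • p + d • (b • c + z)) (a • p + d • (b • c + z)) = 0 → b ∈ Γ := by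
  classical
  have hr := two_le_of_card_eq_sq hF
  -- The value at b is the Hermitian norm of b c + z, the terms in p and `herm r c c` being zero;
  -- the coefficient of b ^ r is nonzero.
  let P : Polynomial F := Polynomial.C (herm r z c) * Polynomial.X ^ r +
    Polynomial.C (herm r c z) * Polynomial.X + Polynomial.C (herm r z z)
  have hP : P ≠ 0 := by
    intro h
    have h1 : P.coeff r = herm r z c := by
      simp [P, Polynomial.coeff_X, Polynomial.coeff_C, show (1 : ℕ) ≠ r by omega,
        show r ≠ 0 by omega]
    rw [h, Polynomial.coeff_zero] at h1
    exact hzc h1.symm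
  have hdeg : P.natDegree ≤ r := by
    have : 1 ≤ r := by omega
    simp only [P]
    compute_degree
    omega
  refine ⟨P.roots.toFinset, (Multiset.toFinset_card_le _).trans
    ((Polynomial.card_roots' P).trans hdeg), fun a b d hd h => ?_⟩
  rw [Multiset.mem_toFinset, Polynomial.mem_roots hP, Polynomial.IsRoot]
  simp only [herm_add_left, herm_smul_left, herm_add_right hF, herm_smul_right, hpp, hcc, hcp, hzp,
    herm_eq_zero_symm hF hcp, herm_eq_zero_symm hF hzp] at h
  have h' : d * d ^ r * P.eval b = 0 := by
    simp only [P, Polynomial.eval_add, Polynomial.eval_mul, Polynomial.eval_C, Polynomial.eval_pow,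
      Polynomial.eval_X]
    linear_combination h
  exact (mul_eq_zero.1 h').resolve_left (mul_ne_zero hd (pow_ne_zero _ hd))

/-- Root multiplicities add up to at most the degree. -/
theorem sum_card_le_of_pow_dvd {F : Type*} [Field F] [Fintype F] {p : Polynomial F} (hp : p ≠ 0)
    {j : F → ℕ} (hj : ∀ t, (Polynomial.X - Polynomial.C t) ^ j t ∣ p) :
    ∑ t, j t ≤ p.natDegree := by
  classical
  refine le_trans (Finset.sum_le_sum fun t _ =>
    (Polynomial.le_rootMultiplicity_iff hp).2 (hj t)) ?_
  simp_rw [← Polynomial.count_roots]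
  rw [Multiset.sum_count_eq_card (fun a _ => Finset.mem_univ a)]
  exact Polynomial.card_roots' p

/-! ### Counting zeros along the lines meeting a fixed line -/

/-- The zeros on the surface of a form of degree `h` that does not vanish at the point `B` of the
line through `A` and `B` of the surface, counted along the lines of the surface meeting this
line. -/
theorem exists_finset_zeros_of_basis {F : Type*} [Field F] [Fintype F] {r h : ℕ}
    (hF : Fintype.card F = r ^ 2) (hh : h < r + 1) {f : MvPolynomial (Fin 4) F}
    (hf : f.IsHomogeneous h) {A B C D : Fin 4 → F} (hAA : herm r A A = 0)
    (hAB : herm r A B = 0) (hBB : herm r B B = 0) (hCA : herm r C A = 1)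
    (hCB : herm r C B = 0) (hDA : herm r D A = 0) (hDB : herm r D B = 1)
    (hspan : ∀ x : Fin 4 → F, ∃ α β γ δ : F, x = α • A + β • B + γ • C + δ • D)
    (hfB : MvPolynomial.eval B f ≠ 0) :
    ∃ T : Finset (Fin 4 → F), T.card ≤ h * (r + 1) * (r ^ 2 + 1) ∧
      ∀ x : Fin 4 → F, x ≠ 0 → herm r x x = 0 → MvPolynomial.eval x f = 0 →
        ∃ y ∈ T, ∃ a : F, x = a • y := by
  classical
  have hr := two_le_of_card_eq_sq hF
  have hq : h + 1 < Fintype.card F := by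
    rw [hF]
    nlinarith
  have hBA := herm_eq_zero_symm hF hAB
  have hdiv {a : F} (ha : a ≠ 0) {x : Fin 4 → F} (hx : MvPolynomial.eval (a • x) f = 0) :
      MvPolynomial.eval x f = 0 := by
    rw [eval_smul_of_isHomogeneous hf] at hx
    exact (mul_eq_zero.1 hx).resolve_left (pow_ne_zero _ ha)
  have hroots (x y : Fin 4 → F) : (linePoly f x y).roots.toFinset.card ≤ h :=
    (Multiset.toFinset_card_le _).trans
      ((Polynomial.card_roots' _).trans (natDegree_linePoly_le hf.totalDegree_le x y))
  have hmem {x y : Fin 4 → F} (hxy : linePoly f x y ≠ 0) {u : F}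
      (hu : MvPolynomial.eval (x + u • y) f = 0) : u ∈ (linePoly f x y).roots.toFinset := by
    rw [Multiset.mem_toFinset, Polynomial.mem_roots hxy, Polynomial.IsRoot, eval_linePoly, hu]
  -- the lines through `B` and the lines through `A + t B`
  obtain ⟨Γ₀, hΓ₀, hΓ₀'⟩ := exists_finset_of_isotropic hF (p := B) (c := A) (z := C) hBB hAA hAB
    hCB (by rw [hCA]; exact one_ne_zero)
  let Q : F → Fin 4 → F := fun t => A + t • B
  -- The coefficient makes R t orthogonal to Q t, so that Q t, B and R t span the tangent plane at Q
  -- t.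
  let R : F → Fin 4 → F := fun t => D + (-t ^ r) • C
  have hΓ (t : F) : ∃ Γ : Finset F, Γ.card ≤ r ∧ ∀ a b d : F, d ≠ 0 →
      herm r (a • Q t + d • (b • B + R t)) (a • Q t + d • (b • B + R t)) = 0 → b ∈ Γ := by
    apply exists_finset_of_isotropic hF <;>
      simp [Q, R, herm_add_left, herm_smul_left, herm_add_right hF, herm_smul_right,
        -neg_smul, *]
  choose Γ hΓcard hΓmem using hΓ
  -- Parameters of the zeros other than Q t itself on the line through Q t and c B + R t; J t
  -- collects the lines of this kind on which f vanishes identically.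
  let Z : F → F → Finset F := fun t c =>
    Finset.univ.filter fun a => MvPolynomial.eval ((c • B + R t) + a • Q t) f = 0
  let J : F → Finset F := fun t => (Γ t).filter fun c => linePoly f (c • B + R t) (Q t) = 0
  have hZ (t c : F) : (Z t c).card ≤
      h + if linePoly f (c • B + R t) (Q t) = 0 then r ^ 2 else 0 := by
    split_ifs with h0
    · refine le_trans (Finset.card_le_univ _) ?_
      omega
    · rw [add_zero]
      refine le_trans (Finset.card_le_card fun a ha => ?_) (hroots (c • B + R t) (Q t))
      exact hmem h0 (Finset.mem_filter.1 ha).2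
  have hφ : linePoly f A B ≠ 0 := linePoly_ne_zero hf hq hfB A
  have hJ : ∑ t, (J t).card ≤ h := by
    refine (sum_card_le_of_pow_dvd hφ fun t => ?_).trans
      (natDegree_linePoly_le hf.totalDegree_le A B)
    refine pow_dvd_linePoly (z := R t) hφ _ fun c hc => ?_
    exact linePoly_swap_eq_zero hf hq (Finset.mem_filter.1 hc).2
  -- T₁ lies on ℓ, T₂ on the further lines through B, T₃ on those through the points A + t B.
  let T₁ := (linePoly f A B).roots.toFinset.image Q
  let T₂ := Γ₀.biUnion fun c =>
    (linePoly f (c • A + C) B).roots.toFinset.image fun a => (c • A + C) + a • B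
  let T₃ := Finset.univ.biUnion fun t => (Γ t).biUnion fun c =>
    (Z t c).image fun a => (c • B + R t) + a • Q t
  have hT₁ : T₁.card ≤ h := Finset.card_image_le.trans (hroots A B)
  have hT₂ : T₂.card ≤ r * h :=
    (Finset.card_biUnion_le_card_mul _ _ h fun c _ => Finset.card_image_le.trans (hroots _ _)).trans
      (Nat.mul_le_mul_right _ hΓ₀)
  have hT₃ : T₃.card ≤ r ^ 2 * (r * h) + r ^ 2 * h := by
    have hstep (t : F) : ((Γ t).biUnion fun c =>
        (Z t c).image fun a => (c • B + R t) + a • Q t).card ≤ r * h + r ^ 2 * (J t).card := by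
      refine Finset.card_biUnion_le.trans ?_
      refine (Finset.sum_le_sum fun c _ => Finset.card_image_le.trans (hZ t c)).trans ?_
      rw [Finset.sum_add_distrib, ← Finset.sum_filter, Finset.sum_const, Finset.sum_const,
        smul_eq_mul, smul_eq_mul, mul_comm _ (r ^ 2)]
      exact Nat.add_le_add_right (Nat.mul_le_mul_right _ (hΓcard t)) _
    refine Finset.card_biUnion_le.trans ((Finset.sum_le_sum fun t _ => hstep t).trans ?_)
    rw [Finset.sum_add_distrib, Finset.sum_const, Finset.card_univ, hF, smul_eq_mul,
      ← Finset.mul_sum]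
    exact Nat.add_le_add_left (Nat.mul_le_mul_left _ hJ) _
  refine ⟨T₁ ∪ (T₂ ∪ T₃), ?_, fun x hx0 hxx hfx => ?_⟩
  · calc (T₁ ∪ (T₂ ∪ T₃)).card ≤ T₁.card + (T₂.card + T₃.card) :=
          (Finset.card_union_le _ _).trans (Nat.add_le_add_left (Finset.card_union_le _ _) _)
      _ ≤ h + (r * h + (r ^ 2 * (r * h) + r ^ 2 * h)) := by omega
      _ = h * (r + 1) * (r ^ 2 + 1) := by ring
  obtain ⟨α, β, γ, δ, rfl⟩ := hspan x
  by_cases hδ : δ = 0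
  · subst hδ
    by_cases hγ : γ = 0
    · subst hγ
      by_cases hα : α = 0
      · subst hα
        have hβ : β ≠ 0 := by
          rintro rfl
          simp at hx0
        refine absurd (hdiv hβ ?_) hfB
        simpa using hfx
      · have hx : α • A + β • B + (0 : F) • C + (0 : F) • D = α • Q (β / α) := by
          simp only [Q, smul_add, smul_smul, mul_div_cancel₀ _ hα, zero_smul, add_zero]
        rw [hx] at hfx ⊢
        refine ⟨_, ?_, _, rfl⟩
        exact Finset.mem_union_left _ (Finset.mem_image_of_mem Q (hmem hφ (hdiv hα hfx)))
    · have hx : α • A + β • B + γ • C + (0 : F) • D =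
          γ • (((α / γ) • A + C) + (β / γ) • B) := by
        simp only [smul_add, smul_smul, mul_div_cancel₀ _ hγ, zero_smul, add_zero]
        abel
      have hx' : α • A + β • B + γ • C + (0 : F) • D = β • B + γ • ((α / γ) • A + C) := by
        simp only [smul_add, smul_smul, mul_div_cancel₀ _ hγ, zero_smul, add_zero]
        abel
      rw [hx'] at hxx
      have hc := hΓ₀' _ _ _ hγ hxx
      rw [hx] at hfx ⊢
      refine ⟨_, ?_, _, rfl⟩
      refine Finset.mem_union_right _ (Finset.mem_union_left _ (Finset.mem_biUnion.2 ⟨_, hc, ?_⟩))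
      exact Finset.mem_image_of_mem (fun a => ((α / γ) • A + C) + a • B)
        (hmem (linePoly_ne_zero hf hq hfB _) (hdiv hγ hfx))
  -- Since x ↦ x ^ r is an involution, every plane through ℓ with δ ≠ 0 is tangent at some A + t B.
  · obtain ⟨t, ht⟩ : ∃ t : F, γ = δ * -t ^ r :=
      ⟨(-γ / δ) ^ r, by rw [pow_pow_of_card_eq_sq hF]; field_simp⟩
    have hx : α • A + β • B + γ • C + δ • D =
        α • Q t + δ • (((β - α * t) / δ) • B + R t) := by
      simp only [Q, R, smul_add, smul_smul, mul_div_cancel₀ _ hδ, ht, sub_smul]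
      abel
    have hx' : α • Q t + δ • (((β - α * t) / δ) • B + R t) =
        δ • ((((β - α * t) / δ) • B + R t) + (α / δ) • Q t) := by
      rw [smul_add δ (_ + _), smul_smul δ (α / δ), mul_div_cancel₀ _ hδ, add_comm]
    rw [hx] at hxx hfx ⊢
    have hc := hΓmem _ _ _ _ hδ hxx
    rw [hx'] at hfx ⊢
    refine ⟨_, ?_, _, rfl⟩
    refine Finset.mem_union_right _ (Finset.mem_union_right _ (Finset.mem_biUnion.2
      ⟨t, Finset.mem_univ _, Finset.mem_biUnion.2 ⟨_, hc, ?_⟩⟩))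
    exact Finset.mem_image_of_mem (fun a => (((β - α * t) / δ) • B + R t) + a • Q t)
      (Finset.mem_filter.2 ⟨Finset.mem_univ _, hdiv hδ hfx⟩)

/-- A nonzero form of degree `h ≤ r` has at most `h (r + 1) (r ^ 2 + 1)` zeros on the surface. -/
theorem exists_finset_zeros {F : Type*} [Field F] [Fintype F] {r h : ℕ}
    (hF : Fintype.card F = r ^ 2) (hh : h < r + 1) {f : MvPolynomial (Fin 4) F}
    (hf : f.IsHomogeneous h) (hf0 : f ≠ 0) :
    ∃ T : Finset (Fin 4 → F), T.card ≤ h * (r + 1) * (r ^ 2 + 1) ∧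
      ∀ x : Fin 4 → F, x ≠ 0 → ∑ i, x i ^ (r + 1) = 0 → MvPolynomial.eval x f = 0 →
        ∃ y ∈ T, ∃ a : F, x = a • y := by
  have hr := two_le_of_card_eq_sq hF
  have hr0 : r ≠ 0 := by omega
  obtain ⟨b, hb1, hb3, hb01, hb23, hfb⟩ := exists_eval_ne_zero hF hh hf.totalDegree_le hf0
  have hb0 : b 0 ≠ 0 := by
    intro h0
    rw [h0, zero_pow (by omega), zero_add] at hb01
    exact pow_ne_zero _ hb1 hb01
  have hb2 : b 2 ≠ 0 := by
    intro h0
    rw [h0, zero_pow (by omega), zero_add] at hb23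
    exact pow_ne_zero _ hb3 hb23
  rw [pow_succ', pow_succ'] at hb01 hb23
  -- By the choice of b, both halves (b₀, b₁, 0, 0) and (0, 0, b₂, b₃) are isotropic, so the line
  -- joining A and b lies in the surface. C and D are dual to A and B under `herm`.
  have := exists_finset_zeros_of_basis hF hh hf (A := ![b 0, b 1, 0, 0]) (B := b)
    (C := ![(b 0 ^ r)⁻¹, 0, -(b 2 ^ r)⁻¹, 0]) (D := ![0, 0, (b 2 ^ r)⁻¹, 0])
    (by simp [herm, Fin.sum_univ_four, hb01])
    (by simp [herm, Fin.sum_univ_four, hb01])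
    (by simp [herm, Fin.sum_univ_four, hb01, hb23])
    (by simp [herm, Fin.sum_univ_four, hb0, hr0])
    (by simp [herm, Fin.sum_univ_four, hb0, hb2])
    (by simp [herm, Fin.sum_univ_four, hr0])
    (by simp [herm, Fin.sum_univ_four, hb2])
    (fun x => by
      refine ⟨x 1 / b 1 - x 3 / b 3, x 3 / b 3, (x 0 - x 1 / b 1 * b 0) * b 0 ^ r,
        (x 2 - x 3 / b 3 * b 2) * b 2 ^ r + (x 0 - x 1 / b 1 * b 0) * b 0 ^ r, ?_⟩
      ext i
      simp only [Pi.add_apply, Pi.smul_apply, smul_eq_mul]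
      fin_cases i <;> simp <;> field_simp <;> ring)
    hfb
  simpa only [herm_self] using this

/-- The number of chosen coordinate vectors at which a nonzero form of degree `h ≤ r` vanishes. -/
theorem IsCoordinateChoice.card_zeros_le {F : Type*} [Field F] [Fintype F] {r h : ℕ}
    (hF : Fintype.card F = r ^ 2) (hh : h < r + 1) {v : rationalPoints F r → Fin 4 → F}
    (hv : IsCoordinateChoice (rationalPoints F r) v) {f : MvPolynomial (Fin 4) F}
    (hf : f.IsHomogeneous h) (hf0 : f ≠ 0) :
    Nat.card {P : rationalPoints F r // MvPolynomial.eval (v P) f = 0} ≤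
      h * (r + 1) * (r ^ 2 + 1) := by
  obtain ⟨T, hT, hcover⟩ := exists_finset_zeros hF hh hf hf0
  have hrep (P : {P : rationalPoints F r // MvPolynomial.eval (v P) f = 0}) :
      ∃ y : T, ∃ a : F, v P = a • (y : Fin 4 → F) := by
    obtain ⟨y, hy, a, ha⟩ := hcover (v P) (hv P).1 (hv.sum_pow_eq_zero P) P.2
    exact ⟨⟨y, hy⟩, a, ha⟩
  choose g a hga using hrep
  have hg : Function.Injective g := by
    intro P P' hPP'
    obtain ⟨h0, hP⟩ := hv P
    obtain ⟨h0', hP'⟩ := hv P'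
    apply Subtype.ext
    apply Subtype.ext
    rw [← hP, ← hP', Projectivization.mk_eq_mk_iff']
    have ha : a P' ≠ 0 := by
      intro h
      apply h0'
      rw [hga P', h, zero_smul]
    refine ⟨a P * (a P')⁻¹, ?_⟩
    rw [hga P, hga P', hPP', smul_smul, inv_mul_cancel_right₀ ha]
  refine (Nat.card_le_card_of_injective g hg).trans ?_
  simpa using hT

/-! ### Parameters of the code -/

theorem mem_evalCode {F σ ι : Type*} [Field F] {h : ℕ} {v : ι → σ → F} {x : ι → F} :
    x ∈ evalCode h v ↔ ∃ f : MvPolynomial σ F, f.IsHomogeneous h ∧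
      (fun P => MvPolynomial.eval (v P) f) = x :=
  Iff.rfl

theorem finrank_evalCode {F : Type*} [Field F] [Fintype F] {r h : ℕ}
    (hF : Fintype.card F = r ^ 2) (hh : h < r + 1) {v : rationalPoints F r → Fin 4 → F}
    (hv : IsCoordinateChoice (rationalPoints F r) v) :
    Module.finrank F (evalCode h v) = (3 + h).choose h := by
  have hinj : Function.Injective
      ((evalMap v).domRestrict (MvPolynomial.homogeneousSubmodule (Fin 4) F h)) := by
    rw [injective_iff_map_eq_zero]
    rintro ⟨f, hf⟩ h0
    have hf' : f.IsHomogeneous h := hf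
    by_contra hne
    have hf0 : f ≠ 0 := fun h => hne (Subtype.ext h)
    obtain ⟨b, hb1, -, hb01, hb23, hfb⟩ := exists_eval_ne_zero hF hh hf'.totalDegree_le hf0
    have hbz : b ≠ 0 := fun h => hb1 (congrFun h 1)
    have hb : ∑ i, b i ^ (r + 1) = 0 := by
      rw [Fin.sum_univ_four, hb01, zero_add, hb23]
    let P : rationalPoints F r :=
      ⟨Projectivization.mk F b hbz, (mk_mem_rationalPoints hbz).2 hb⟩
    obtain ⟨hP0, hP⟩ := hv P
    obtain ⟨a, ha⟩ := (Projectivization.mk_eq_mk_iff' F b (v P) hbz hP0).1 hP.symm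
    apply hfb
    have h0P : MvPolynomial.eval (v P) f = 0 := congrFun h0 P
    rw [← ha, eval_smul_of_isHomogeneous hf', h0P, mul_zero]
  have := LinearMap.finrank_range_of_inj hinj
  rw [LinearMap.range_domRestrict, finrank_homogeneousSubmodule] at this
  rw [evalCode, this]
  congr 1
  omega

theorem le_minDist_evalCode {F : Type*} [Field F] [Fintype F] {r h : ℕ}
    (hF : Fintype.card F = r ^ 2) (hh : h < r + 1) {v : rationalPoints F r → Fin 4 → F}
    (hv : IsCoordinateChoice (rationalPoints F r) v) :
    (Nat.card (rationalPoints F r) : ℤ) - h * (r + 1) * (r ^ 2 + 1) ≤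
      (minDist (evalCode h v) : ℤ) := by
  classical
  let := Fintype.ofFinite (rationalPoints F r)
  -- The infimum of an empty set of naturals would be 0; the positive dimension excludes this.
  have hne : {d | ∃ x ∈ evalCode h v, ∃ y ∈ evalCode h v, x ≠ y ∧ hammingDist x y = d}.Nonempty := by
    have hbot : evalCode h v ≠ ⊥ := by
      intro hbot
      have hk := finrank_evalCode hF hh hv
      rw [hbot, finrank_bot] at hk
      exact (Nat.choose_pos (Nat.le_add_left h 3)).ne hk
    obtain ⟨x, hx, hx0⟩ := Submodule.exists_mem_ne_zero_of_ne_bot hbot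
    exact ⟨_, x, hx, 0, zero_mem _, hx0, rfl⟩
  obtain ⟨x, hx, y, hy, hxy, hd⟩ := Nat.sInf_mem hne
  have hd' : hammingDist x y = minDist (evalCode h v) := by
    rw [hd, minDist]
  rw [← hd']
  obtain ⟨f, hf, hfx⟩ := mem_evalCode.1 (sub_mem hx hy)
  have hf0 : f ≠ 0 := by
    rintro rfl
    apply hxy
    rw [← sub_eq_zero, ← hfx]
    ext P
    simp
  have hzeros := hv.card_zeros_le hF hh hf hf0
  have heq (P : rationalPoints F r) : MvPolynomial.eval (v P) f = 0 ↔ x P = y P := by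
    rw [← sub_eq_zero (a := x P), ← Pi.sub_apply, ← hfx]
  simp only [heq] at hzeros
  rw [Nat.card_eq_fintype_card, Fintype.card_subtype] at hzeros
  have hsum := Finset.card_filter_add_card_filter_not
    (s := (Finset.univ : Finset (rationalPoints F r))) (fun P => x P = y P)
  rw [Finset.card_univ, ← Nat.card_eq_fintype_card] at hsum
  have hham : hammingDist x y = (Finset.univ.filter fun P => ¬ x P = y P).card := rfl
  rw [hham, ← hsum]
  zify at hzeros
  push_cast
  linarith

end HermitianSurfaceCode

theorem mainTheorem6 (r h : ℕ) (F : Type*) [Field F] [Finite F] (hF : Nat.card F = r ^ 2)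
    (hh : h < r + 1)
    (v : HermitianSurfaceCode.rationalPoints F r → Fin 4 → F)
    (hv : HermitianSurfaceCode.IsCoordinateChoice (HermitianSurfaceCode.rationalPoints F r) v) :
    Nat.card (HermitianSurfaceCode.rationalPoints F r) = (r ^ 2 + 1) * (r ^ 3 + 1) ∧
    Module.finrank F (HermitianSurfaceCode.evalCode h v) = Nat.choose (3 + h) h ∧
    (Nat.card (HermitianSurfaceCode.rationalPoints F r) : ℤ) - h * (r + 1) * (r ^ 2 + 1) ≤
      (HermitianSurfaceCode.minDist (HermitianSurfaceCode.evalCode h v) : ℤ) := by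
  have := Fintype.ofFinite F
  rw [Nat.card_eq_fintype_card] at hF
  exact ⟨HermitianSurfaceCode.card_rationalPoints hF hv,
    HermitianSurfaceCode.finrank_evalCode hF hh hv,
    HermitianSurfaceCode.le_minDist_evalCode hF hh hv⟩
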